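/- For $n \in \mathbb{N} = \{0, 1, 2, \ldots\}$ let $H_n^{(2)} = \sum_{0 < j \le n} \frac{1}{j^2}$ (so that $H_0^{(2)} = 0$). Then $$\sum_{k=1}^\infty \frac{(21k-8) H_{k-1}^{(2)} + \frac{2}{k}}{k^3 \binom{2k}{k}^3} = \frac{\pi^4}{360}$$ and $$\sum_{k=1}^\infty \frac{16^k}{k^3 \binom{2k}{k}^3} \left( (6k-2) H_{k-1}^{(2)} + \frac{1}{k} \right) = \frac{\pi^4}{24}.$$ -/

import Mathlib

/-- The generalized harmonic number of order `m`: the rational number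
`H_n^{(m)} = ∑_{0 < j ≤ n} 1 / j ^ m`. -/
def genHarmonic (m n : ℕ) : ℚ :=
  ∑ j ∈ Finset.Icc 1 n, 1 / (j : ℚ) ^ m

/-! ### Summation by WZ pairs and sums over `j < k`. -/

open Filter Topology Finset

/-! Each series is, up to a constant factor, the boundary sum `∑ G n 0` of a WZ pair with `F = term
* harm` and `G = companion`. By `hasSum_of_wz_pair` it equals `∑ F 0 k`, which is the sum of `x j *
x k` over `j < k`, with `x` the inverse squares of integers (first series) or of half-integers
(second). `hasSum_mul_sum_range` evaluates this as half of `(∑ x) ^ 2 - ∑ x ^ 2`, so only ζ(2) and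
ζ(4) enter. -/

/-- A telescoping criterion: if `(F, G)` is a WZ pair, `F n` decays geometrically in `n` under a
summable majorant and `G n k → 0` as `k → ∞`, then `∑ G n 0 = ∑ F 0 k`. -/
theorem hasSum_of_wz_pair {F G : ℕ → ℕ → ℝ} {b : ℕ → ℝ} {s : ℝ}
    (hwz : ∀ n k, F (n + 1) k - F n k = G n (k + 1) - G n k) (hb : Summable b)
    (hF : ∀ n k, |F n k| ≤ (1 / 2) ^ n * b k) (hlim : ∀ n, Tendsto (G n) atTop (𝓝 0))
    (hG : ∀ n, 0 ≤ G n 0) (hs : HasSum (F 0) s) : HasSum (fun n => G n 0) s := by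
  have hsum : ∀ n, Summable (F n) := fun n =>
    Summable.of_norm_bounded (hb.mul_left _) (hF n)
  -- Summed over `k`, the right side of the WZ relation telescopes to `-G n 0`, since `G n k → 0`.
  have hstep : ∀ n, ∑' k, F n k - ∑' k, F (n + 1) k = G n 0 := by
    intro n
    have h1 : HasSum (fun k => F (n + 1) k - F n k) (∑' k, F (n + 1) k - ∑' k, F n k) :=
      (hsum _).hasSum.sub (hsum _).hasSum
    have h2 := h1.tendsto_sum_nat
    simp only [hwz, sum_range_sub] at h2
    have h3 := tendsto_nhds_unique h2 ((hlim n).sub_const (G n 0))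
    linarith
  have hpartial : ∀ N, ∑ n ∈ range N, G n 0 = s - ∑' k, F N k := by
    intro N
    rw [← hs.tsum_eq, ← sum_range_sub' (fun n => ∑' k, F n k)]
    exact sum_congr rfl fun n _ => (hstep n).symm
  rw [hasSum_iff_tendsto_nat_of_nonneg hG]
  simp only [hpartial]
  have hpow : Tendsto (fun N : ℕ => (1 / 2 : ℝ) ^ N * ∑' k, b k) atTop (𝓝 0) := by
    simpa using (tendsto_pow_atTop_nhds_zero_of_lt_one (by norm_num : (0 : ℝ) ≤ 1 / 2)
      (by norm_num)).mul_const (∑' k, b k)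
  have h0 : Tendsto (fun N => ∑' k, F N k) atTop (𝓝 0) := by
    refine squeeze_zero_norm (fun N => ?_) hpow
    exact tsum_of_norm_bounded (hb.hasSum.mul_left _) (hF N)
  simpa using h0.const_sub s

theorem two_mul_sum_mul_sum_range (x : ℕ → ℝ) (n : ℕ) :
    2 * ∑ k ∈ range n, x k * ∑ j ∈ range k, x j =
      (∑ k ∈ range n, x k) ^ 2 - ∑ k ∈ range n, x k ^ 2 := by
  induction n with
  | zero => simp
  | succ n ih => simp only [sum_range_succ]; linear_combination ih

theorem hasSum_mul_sum_range {x : ℕ → ℝ} {a b : ℝ} (hx : ∀ n, 0 ≤ x n) (ha : HasSum x a)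
    (hb : HasSum (fun n => x n ^ 2) b) :
    HasSum (fun k => x k * ∑ j ∈ range k, x j) ((a ^ 2 - b) / 2) := by
  rw [hasSum_iff_tendsto_nat_of_nonneg fun k => mul_nonneg (hx k) (sum_nonneg fun j _ => hx j)]
  refine (((ha.tendsto_sum_nat.pow 2).sub hb.tendsto_sum_nat).div_const 2).congr fun n => ?_
  rw [← two_mul_sum_mul_sum_range]
  ring

/-! ### Inverse squares of integers and half-integers. -/

/-- The inverse squares `1 / (j + 1) ^ 2`. -/
noncomputable def invSq (j : ℕ) : ℝ := 1 / ((j : ℝ) + 1) ^ 2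

/-- The inverse squares `1 / (j + 1 / 2) ^ 2` of half-integers. -/
noncomputable def halfInvSq (j : ℕ) : ℝ := 1 / ((j : ℝ) + 1 / 2) ^ 2

theorem invSq_nonneg (j : ℕ) : 0 ≤ invSq j := by unfold invSq; positivity

theorem halfInvSq_nonneg (j : ℕ) : 0 ≤ halfInvSq j := by unfold halfInvSq; positivity

theorem hasSum_invSq : HasSum invSq (Real.pi ^ 2 / 6) := by
  have h := (hasSum_nat_add_iff' 1).mpr hasSum_zeta_two
  convert! h using 1
  · ext j
    simp [invSq]
  · simp

theorem hasSum_invSq_sq : HasSum (fun j => invSq j ^ 2) (Real.pi ^ 4 / 90) := by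
  have h := (hasSum_nat_add_iff' 1).mpr hasSum_zeta_four
  convert! h using 1
  · ext j
    simp [invSq, ← pow_mul]
  · simp

/-- The even terms contribute `a / 2 ^ p`, so the odd ones give the rest; halving the odd integers
rescales by `2 ^ p`. -/
theorem hasSum_one_div_add_half_pow {p : ℕ} {a : ℝ}
    (h : HasSum (fun n : ℕ => 1 / (n : ℝ) ^ p) a) :
    HasSum (fun j : ℕ => 1 / ((j : ℝ) + 1 / 2) ^ p) ((2 ^ p - 1) * a) := by
  have he : HasSum (fun j : ℕ => 1 / ((2 * j : ℕ) : ℝ) ^ p) (1 / 2 ^ p * a) := by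
    convert! h.mul_left (1 / 2 ^ p) using 1
    ext j
    push_cast
    rw [mul_pow, div_mul_div_comm, one_mul]
  have ho : Summable fun j : ℕ => 1 / ((2 * j + 1 : ℕ) : ℝ) ^ p :=
    h.summable.comp_injective (i := fun j : ℕ => 2 * j + 1) fun i j hij => by
      simpa using hij
  have hsum :=
    (HasSum.even_add_odd (f := fun n : ℕ => 1 / (n : ℝ) ^ p) he ho.hasSum).unique h
  have h2 : (2 : ℝ) ^ p ≠ 0 := by positivity
  have hval : 2 ^ p * ∑' j : ℕ, 1 / ((2 * j + 1 : ℕ) : ℝ) ^ p = (2 ^ p - 1) * a := by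
    rw [eq_sub_of_add_eq' hsum]
    field_simp
  rw [← hval]
  convert! ho.hasSum.mul_left (2 ^ p) using 1
  ext j
  have : ((j : ℝ) + 1 / 2) = ((2 * j + 1 : ℕ) : ℝ) / 2 := by push_cast; ring
  rw [this, div_pow, one_div_div, mul_one_div]

theorem hasSum_halfInvSq : HasSum halfInvSq (Real.pi ^ 2 / 2) := by
  have h := hasSum_one_div_add_half_pow hasSum_zeta_two
  convert! h using 1
  ring

theorem hasSum_halfInvSq_sq : HasSum (fun j => halfInvSq j ^ 2) (Real.pi ^ 4 / 6) := by
  have h := hasSum_one_div_add_half_pow hasSum_zeta_four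
  convert! h using 1
  · ext j
    rw [halfInvSq, div_pow, one_pow, ← pow_mul]
  · ring

theorem sum_range_invSq_le (n : ℕ) : ∑ j ∈ range n, invSq j ≤ Real.pi ^ 2 / 6 :=
  sum_le_hasSum _ (fun j _ => invSq_nonneg j) hasSum_invSq

theorem sum_range_halfInvSq_le (n : ℕ) : ∑ j ∈ range n, halfInvSq j ≤ Real.pi ^ 2 / 2 :=
  sum_le_hasSum _ (fun j _ => halfInvSq_nonneg j) hasSum_halfInvSq

theorem genHarmonic_two_eq (n : ℕ) : (genHarmonic 2 n : ℝ) = ∑ j ∈ range n, invSq j := by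
  induction n with
  | zero => simp [genHarmonic]
  | succ n ih =>
    rw [sum_range_succ, ← ih, genHarmonic, genHarmonic, sum_Icc_succ_top (by omega)]
    push_cast [invSq]
    rfl

theorem factorial_two_mul_add_two (n : ℕ) :
    ((2 * (n + 1)).factorial : ℝ) = (2 * n + 2) * (2 * n + 1) * (2 * n).factorial := by
  rw [show 2 * (n + 1) = 2 * n + 1 + 1 by ring, Nat.factorial_succ, Nat.factorial_succ]
  push_cast
  ring

theorem cast_choose_two_mul (n : ℕ) :
    ((2 * n).choose n : ℝ) = (2 * n).factorial / (n.factorial : ℝ) ^ 2 := by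
  rw [Nat.cast_choose ℝ (by omega : n ≤ 2 * n), show 2 * n - n = n by omega, sq]

theorem tendsto_const_div_add_one (c : ℝ) :
    Tendsto (fun k : ℕ => c / ((k : ℝ) + 1)) atTop (𝓝 0) := by
  simpa [div_eq_mul_inv] using
    (tendsto_one_div_add_atTop_nhds_zero_nat (𝕜 := ℝ)).const_mul c

theorem le_half_pow_mul_of_ratio {f : ℕ → ℕ → ℝ} {b : ℕ → ℝ}
    (h0 : ∀ k, f 0 k ≤ b k) (hstep : ∀ n k, f (n + 1) k ≤ 1 / 2 * f n k) (n k : ℕ) :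
    f n k ≤ (1 / 2) ^ n * b k := by
  induction n with
  | zero => simpa using h0 k
  | succ n ih => rw [pow_succ]; linarith [hstep n k]

/-! ### The series with ratio 1/64. -/

namespace CubeSeries

/-- The hypergeometric part of the WZ pair for the series with ratio `1 / 64`. -/
noncomputable def term (n k : ℕ) : ℝ :=
  ((n + k).factorial : ℝ) ^ 2 * (n.factorial : ℝ) ^ 4 /
    ((2 * n).factorial * ((2 * n + k + 1).factorial : ℝ) ^ 2)

/-- The harmonic part of the WZ pair. -/
noncomputable def harm (n k : ℕ) : ℝ :=
  ∑ j ∈ range (n + k), invSq j + 2 * ∑ j ∈ range n, invSq j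

/-- The companion of `term * harm`. -/
noncomputable def companion (n k : ℕ) : ℝ :=
  term n k * ((((n : ℝ) + 1) ^ 4 + 2 * (n + 1) * (2 * n + k + 2) ^ 3 +
      ((n + 1) ^ 2 - 2 * (n + 1)) * (2 * n + k + 2) ^ 2) * harm n k +
      2 * (n + 1) ^ 2 + (2 * n + k + 2) ^ 2) /
    ((2 * n + 2) * (2 * n + 1) * (2 * n + k + 2) ^ 2)

theorem term_pos (n k : ℕ) : 0 < term n k := by unfold term; positivity

theorem term_succ_left (n k : ℕ) :
    term (n + 1) k = term n k * (((n : ℝ) + k + 1) ^ 2 * (n + 1) ^ 4 /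
      ((2 * n + 2) * (2 * n + 1) * ((2 * n + k + 2) ^ 2 * (2 * n + k + 3) ^ 2))) := by
  rw [term, term, factorial_two_mul_add_two, show n + 1 + k = n + k + 1 by ring,
    show 2 * (n + 1) + k + 1 = 2 * n + k + 1 + 1 + 1 by ring]
  simp only [Nat.factorial_succ (n + k), Nat.factorial_succ n,
    Nat.factorial_succ (2 * n + k + 1 + 1), Nat.factorial_succ (2 * n + k + 1)]
  push_cast
  field_simp
  ring

theorem term_succ_right (n k : ℕ) :
    term n (k + 1) = term n k * (((n : ℝ) + k + 1) ^ 2 / (2 * n + k + 2) ^ 2) := by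
  rw [term, term, ← add_assoc, show 2 * n + (k + 1) + 1 = 2 * n + k + 1 + 1 by ring]
  simp only [Nat.factorial_succ (n + k), Nat.factorial_succ (2 * n + k + 1)]
  push_cast
  field_simp
  ring

theorem harm_succ_left (n k : ℕ) :
    harm (n + 1) k = harm n k + 1 / ((n : ℝ) + k + 1) ^ 2 + 2 / ((n : ℝ) + 1) ^ 2 := by
  rw [harm, harm, show n + 1 + k = n + k + 1 by ring, sum_range_succ, sum_range_succ]
  simp only [invSq]
  push_cast
  ring

theorem harm_succ_right (n k : ℕ) :
    harm n (k + 1) = harm n k + 1 / ((n : ℝ) + k + 1) ^ 2 := by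
  rw [harm, harm, ← add_assoc, sum_range_succ]
  simp only [invSq]
  push_cast
  ring

/-- Shifts multiply `term` by rational functions and add rational functions to `harm`; what remains
is a rational identity, linear in `harm n k`. -/
theorem wz_pair (n k : ℕ) :
    term (n + 1) k * harm (n + 1) k - term n k * harm n k =
      companion n (k + 1) - companion n k := by
  simp only [companion, term_succ_left, term_succ_right, harm_succ_left, harm_succ_right]
  push_cast
  field_simp
  ring

theorem harm_nonneg (n k : ℕ) : 0 ≤ harm n k :=
  add_nonneg (sum_nonneg fun j _ => invSq_nonneg j)
    (mul_nonneg zero_le_two (sum_nonneg fun j _ => invSq_nonneg j))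

theorem harm_le (n k : ℕ) : harm n k ≤ Real.pi ^ 2 / 2 := by
  unfold harm
  linarith [sum_range_invSq_le (n + k), sum_range_invSq_le n]

theorem term_zero_left (k : ℕ) : term 0 k = invSq k := by
  simp only [term, invSq, zero_add, mul_zero, Nat.factorial_succ, Nat.factorial_zero]
  push_cast
  field_simp

theorem term_le (n k : ℕ) : term n k ≤ (1 / 2) ^ n * invSq k := by
  refine le_half_pow_mul_of_ratio (fun k => (term_zero_left k).le) (fun n k => ?_) n k
  rw [term_succ_left, mul_comm]
  refine mul_le_mul_of_nonneg_right ?_ (term_pos n k).le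
  rw [div_le_div_iff₀ (by positivity) two_pos]
  have hk : (0 : ℝ) ≤ k := k.cast_nonneg
  have hn : (0 : ℝ) ≤ n := n.cast_nonneg
  have h1 : ((n : ℝ) + k + 1) ^ 2 ≤ (2 * n + k + 2) ^ 2 := by gcongr <;> linarith
  have h2 : ((n : ℝ) + 1) ^ 2 ≤ (2 * n + k + 3) ^ 2 := by gcongr <;> linarith
  -- This alone supplies the ratio 1/2, with equality at `n = 0`.
  have h3 : ((n : ℝ) + 1) ^ 2 * 2 ≤ (2 * n + 2) * (2 * n + 1) := by nlinarith
  calc ((n : ℝ) + k + 1) ^ 2 * (n + 1) ^ 4 * (2 : ℝ)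
      = (((n : ℝ) + 1) ^ 2 * 2) * ((n + k + 1) ^ 2 * (n + 1) ^ 2) := by ring
    _ ≤ ((2 * (n : ℝ) + 2) * (2 * n + 1)) * ((2 * n + k + 2) ^ 2 * (2 * n + k + 3) ^ 2) := by gcongr
    _ = _ := by ring

theorem companion_nonneg (n k : ℕ) : 0 ≤ companion n k := by
  have hk : (0 : ℝ) ≤ k := k.cast_nonneg
  have hn : (0 : ℝ) ≤ n := n.cast_nonneg
  have hE := harm_nonneg n k
  have ht := (term_pos n k).le
  have hq : 0 ≤ ((n : ℝ) + 1) ^ 4 + 2 * (n + 1) * (2 * n + k + 2) ^ 3 +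
      ((n + 1) ^ 2 - 2 * (n + 1)) * (2 * n + k + 2) ^ 2 := by
    -- The cubic term absorbs the negative `-2 * (n + 1)`.
    have : ((n : ℝ) + 1) ^ 4 + 2 * (n + 1) * (2 * n + k + 2) ^ 3 +
      ((n + 1) ^ 2 - 2 * (n + 1)) * (2 * n + k + 2) ^ 2 = ((n : ℝ) + 1) ^ 4 +
        (n + 1) * (2 * (2 * n + k + 1) + (n + 1)) * (2 * n + k + 2) ^ 2 := by ring
    rw [this]
    positivity
  unfold companion
  positivity

theorem companion_le (n k : ℕ) :
    companion n k ≤ (8 * ((n : ℝ) + 1) ^ 2 * (Real.pi ^ 2 / 2) + 3) / ((k : ℝ) + 1) := by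
  have hk : (0 : ℝ) ≤ k := k.cast_nonneg
  have hn : (0 : ℝ) ≤ n := n.cast_nonneg
  have hE := harm_nonneg n k
  have ht : term n k ≤ 1 / ((k : ℝ) + 1) ^ 2 := by
    refine (term_le n k).trans ?_
    exact mul_le_of_le_one_left (invSq_nonneg k) (pow_le_one₀ (by norm_num) (by norm_num))
  have hw : (0 : ℝ) < 2 * n + k + 2 := by positivity
  have hmw : (n : ℝ) + 1 ≤ 2 * n + k + 2 := by linarith
  have hwk : (2 * n + k + 2 : ℝ) ≤ 2 * (n + 1) * (k + 1) := by nlinarith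
  generalize hW : (2 * n + k + 2 : ℝ) = w at *
  generalize hM : (n : ℝ) + 1 = m at *
  have hm : 1 ≤ m := by linarith
  have hq : m ^ 4 + 2 * m * w ^ 3 + (m ^ 2 - 2 * m) * w ^ 2 ≤
      8 * m ^ 2 * (k + 1) * w ^ 2 := by
    have h1 : m ^ 4 ≤ m * w ^ 3 := by
      calc m ^ 4 = m * m ^ 3 := by ring
        _ ≤ m * w ^ 3 := by gcongr
    have h2 : m ^ 2 * w ^ 2 ≤ m * w ^ 3 := by
      calc m ^ 2 * w ^ 2 = m * (m * w ^ 2) := by ring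
        _ ≤ m * (w * w ^ 2) := by gcongr
        _ = m * w ^ 3 := by ring
    have h3 : 4 * m * w ^ 3 ≤ 8 * m ^ 2 * (k + 1) * w ^ 2 := by
      calc 4 * m * w ^ 3 = 4 * m * w ^ 2 * w := by ring
        _ ≤ 4 * m * w ^ 2 * (2 * m * (k + 1)) := by gcongr
        _ = _ := by ring
    have h4 : 0 ≤ 2 * m * w ^ 2 := by positivity
    linarith
  have hnum : (m ^ 4 + 2 * m * w ^ 3 + (m ^ 2 - 2 * m) * w ^ 2) * harm n k + 2 * m ^ 2 + w ^ 2 ≤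
      (8 * m ^ 2 * (Real.pi ^ 2 / 2) + 3) * (k + 1) * w ^ 2 := by
    have h1 : (m ^ 4 + 2 * m * w ^ 3 + (m ^ 2 - 2 * m) * w ^ 2) * harm n k ≤
        8 * m ^ 2 * (k + 1) * w ^ 2 * (Real.pi ^ 2 / 2) := by
      refine (mul_le_mul_of_nonneg_right hq hE).trans ?_
      exact mul_le_mul_of_nonneg_left (harm_le n k) (by positivity)
    have h2 : m ^ 2 ≤ w ^ 2 := by gcongr
    have h3 : w ^ 2 ≤ (k + 1) * w ^ 2 := by nlinarith [sq_nonneg w]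
    nlinarith
  have hd : 1 * w ^ 2 ≤ (2 * n + 2) * (2 * n + 1) * w ^ 2 := by
    gcongr
    nlinarith
  unfold companion
  rw [hW, hM]
  calc _ ≤ 1 / ((k : ℝ) + 1) ^ 2 * ((8 * m ^ 2 * (Real.pi ^ 2 / 2) + 3) * (k + 1) * w ^ 2) /
        (1 * w ^ 2) := by
        refine div_le_div₀ (by positivity) ?_ (by positivity) hd
        refine (mul_le_mul_of_nonneg_left hnum (term_pos n k).le).trans ?_
        exact mul_le_mul_of_nonneg_right ht (by positivity)
    _ = _ := by field_simp

/-- At `k = 0` both sums in `harm` run over `range n`, whence the factor 3. -/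
theorem companion_zero_right (n : ℕ) :
    companion n 0 = 3 * (((21 * ((n : ℝ) + 1) - 8) * ∑ j ∈ range n, invSq j + 2 / ((n : ℝ) + 1)) /
      (((n : ℝ) + 1) ^ 3 * ((2 * (n + 1)).choose (n + 1) : ℝ) ^ 3)) := by
  rw [cast_choose_two_mul, factorial_two_mul_add_two, companion, term, harm]
  simp only [add_zero, Nat.factorial_succ, Nat.cast_zero]
  push_cast
  field_simp
  ring

theorem hasSum_companion : HasSum (fun n => companion n 0) (Real.pi ^ 4 / 120) := by
  have hsum : HasSum (fun k => term 0 k * harm 0 k) (Real.pi ^ 4 / 120) := by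
    have h := hasSum_mul_sum_range invSq_nonneg hasSum_invSq hasSum_invSq_sq
    convert! h using 1
    · ext k
      simp [term_zero_left, harm]
    · ring
  refine hasSum_of_wz_pair (F := fun n k => term n k * harm n k) wz_pair
    (hasSum_invSq.summable.mul_right (Real.pi ^ 2 / 2)) (fun n k => ?_) (fun n => ?_)
    (fun n => companion_nonneg n 0) hsum
  · rw [abs_of_nonneg (mul_nonneg (term_pos n k).le (harm_nonneg n k)), ← mul_assoc]
    exact mul_le_mul (term_le n k) (harm_le n k) (harm_nonneg n k)
      (mul_nonneg (by positivity) (invSq_nonneg k))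
  · exact squeeze_zero (companion_nonneg n) (companion_le n) (tendsto_const_div_add_one _)

end CubeSeries

/-! ### The series with ratio 1/4. -/

namespace QuarterSeries

/-- The hypergeometric part of the WZ pair for the series with ratio `1 / 4`. -/
noncomputable def term (n k : ℕ) : ℝ :=
  (n.factorial : ℝ) ^ 4 / (2 * n).factorial *
    ((∏ j ∈ range k, ((j : ℝ) + 1 / 2)) / ∏ j ∈ range (n + k + 1), ((j : ℝ) + 1 / 2)) ^ 2

/-- The harmonic part of the WZ pair. -/
noncomputable def harm (n k : ℕ) : ℝ :=
  2 * ∑ j ∈ range n, invSq j + ∑ j ∈ range k, halfInvSq j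

/-- The companion of `term * harm`. -/
noncomputable def companion (n k : ℕ) : ℝ :=
  term n k * (((n : ℝ) + 1) * (2 * k + 3 * n + 2) * harm n k + 1) / ((2 * n + 2) * (2 * n + 1))

theorem prod_pos (n : ℕ) : 0 < ∏ j ∈ range n, ((j : ℝ) + 1 / 2) :=
  Finset.prod_pos fun j _ => by positivity

theorem term_pos (n k : ℕ) : 0 < term n k := by
  have h1 := prod_pos k
  have h2 := prod_pos (n + k + 1)
  unfold term
  positivity

theorem term_succ_left (n k : ℕ) :
    term (n + 1) k = term n k * (((n : ℝ) + 1) ^ 4 /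
      ((2 * n + 2) * (2 * n + 1) * (n + k + 3 / 2) ^ 2)) := by
  have h2 := prod_pos (n + k + 1)
  rw [term, term, factorial_two_mul_add_two, show n + 1 + k + 1 = n + k + 1 + 1 by ring,
    prod_range_succ _ (n + k + 1), Nat.factorial_succ]
  generalize ∏ j ∈ range (n + k + 1), ((j : ℝ) + 1 / 2) = p at *
  push_cast
  rw [show (n : ℝ) + k + 1 + 1 / 2 = n + k + 3 / 2 by ring]
  field_simp

theorem term_succ_right (n k : ℕ) :
    term n (k + 1) = term n k * (((k : ℝ) + 1 / 2) ^ 2 / (n + k + 3 / 2) ^ 2) := by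
  have h1 := prod_pos k
  have h2 := prod_pos (n + k + 1)
  rw [term, term, ← add_assoc, prod_range_succ _ (n + k + 1), prod_range_succ _ k]
  generalize ∏ j ∈ range (n + k + 1), ((j : ℝ) + 1 / 2) = p at *
  generalize ∏ j ∈ range k, ((j : ℝ) + 1 / 2) = q at *
  push_cast
  rw [show (n : ℝ) + k + 1 + 1 / 2 = n + k + 3 / 2 by ring]
  field_simp

theorem harm_succ_left (n k : ℕ) :
    harm (n + 1) k = harm n k + 2 / ((n : ℝ) + 1) ^ 2 := by
  rw [harm, harm, sum_range_succ]
  simp only [invSq]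
  ring

theorem harm_succ_right (n k : ℕ) :
    harm n (k + 1) = harm n k + 1 / ((k : ℝ) + 1 / 2) ^ 2 := by
  rw [harm, harm, sum_range_succ]
  simp only [halfInvSq]
  ring

theorem wz_pair (n k : ℕ) :
    term (n + 1) k * harm (n + 1) k - term n k * harm n k =
      companion n (k + 1) - companion n k := by
  simp only [companion, term_succ_left, term_succ_right, harm_succ_left, harm_succ_right]
  push_cast
  field_simp
  ring

theorem harm_nonneg (n k : ℕ) : 0 ≤ harm n k :=
  add_nonneg (mul_nonneg zero_le_two (sum_nonneg fun j _ => invSq_nonneg j))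
    (sum_nonneg fun j _ => halfInvSq_nonneg j)

theorem harm_le (n k : ℕ) : harm n k ≤ Real.pi ^ 2 := by
  unfold harm
  linarith [sum_range_invSq_le n, sum_range_halfInvSq_le k, sq_nonneg Real.pi]

theorem term_zero_left (k : ℕ) : term 0 k = halfInvSq k := by
  have h := prod_pos k
  rw [term, halfInvSq, zero_add, prod_range_succ]
  generalize ∏ j ∈ range k, ((j : ℝ) + 1 / 2) = p at *
  simp only [mul_zero, Nat.factorial_zero]
  push_cast
  field_simp

theorem term_le (n k : ℕ) : term n k ≤ (1 / 2) ^ n * halfInvSq k := by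
  refine le_half_pow_mul_of_ratio (fun k => (term_zero_left k).le) (fun n k => ?_) n k
  rw [term_succ_left, mul_comm]
  refine mul_le_mul_of_nonneg_right ?_ (term_pos n k).le
  rw [div_le_div_iff₀ (by positivity) two_pos]
  have hk : (0 : ℝ) ≤ k := k.cast_nonneg
  have hn : (0 : ℝ) ≤ n := n.cast_nonneg
  have h2 : ((n : ℝ) + 1) ^ 2 ≤ (n + k + 3 / 2) ^ 2 := by
    gcongr
    · linarith
    · norm_num
  have h3 : ((n : ℝ) + 1) ^ 2 * 2 ≤ (2 * n + 2) * (2 * n + 1) := by nlinarith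
  calc ((n : ℝ) + 1) ^ 4 * (2 : ℝ) = (((n : ℝ) + 1) ^ 2 * 2) * (n + 1) ^ 2 := by ring
    _ ≤ ((2 * (n : ℝ) + 2) * (2 * n + 1)) * (n + k + 3 / 2) ^ 2 := by gcongr
    _ = _ := by ring

theorem companion_nonneg (n k : ℕ) : 0 ≤ companion n k := by
  have hE := harm_nonneg n k
  have ht := (term_pos n k).le
  unfold companion
  positivity

theorem companion_le (n k : ℕ) :
    companion n k ≤ 4 * (3 * ((n : ℝ) + 1) ^ 2 * Real.pi ^ 2 + 1) / ((k : ℝ) + 1) := by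
  have hk : (0 : ℝ) ≤ k := k.cast_nonneg
  have hn : (0 : ℝ) ≤ n := n.cast_nonneg
  have ht : term n k ≤ 4 / ((k : ℝ) + 1) ^ 2 := by
    refine (term_le n k).trans ?_
    refine (mul_le_of_le_one_left (halfInvSq_nonneg k)
      (pow_le_one₀ (by norm_num) (by norm_num))).trans ?_
    -- The 4 comes from `k + 1 / 2 ≥ (k + 1) / 2`.
    rw [halfInvSq, div_le_div_iff₀ (by positivity) (by positivity)]
    nlinarith
  have hnum : ((n : ℝ) + 1) * (2 * k + 3 * n + 2) * harm n k + 1 ≤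
      (3 * ((n : ℝ) + 1) ^ 2 * Real.pi ^ 2 + 1) * (k + 1) := by
    have h1 : (2 * k + 3 * n + 2 : ℝ) ≤ 3 * (n + 1) * (k + 1) := by nlinarith
    calc ((n : ℝ) + 1) * (2 * k + 3 * n + 2) * harm n k + 1
        ≤ ((n : ℝ) + 1) * (3 * (n + 1) * (k + 1)) * Real.pi ^ 2 + 1 * (k + 1) := by
          have h2 := harm_nonneg n k
          have h3 := harm_le n k
          gcongr
          linarith
      _ = _ := by ring
  have hd : (1 : ℝ) ≤ (2 * n + 2) * (2 * n + 1) := by nlinarith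
  unfold companion
  calc _ ≤ 4 / ((k : ℝ) + 1) ^ 2 * ((3 * ((n : ℝ) + 1) ^ 2 * Real.pi ^ 2 + 1) * (k + 1)) / 1 := by
        refine div_le_div₀ (by positivity) ?_ one_pos hd
        refine (mul_le_mul_of_nonneg_left hnum (term_pos n k).le).trans ?_
        exact mul_le_mul_of_nonneg_right ht (by positivity)
    _ = _ := by field_simp

/-- Its square is the source of the powers of 16. -/
theorem prod_range_add_half (n : ℕ) :
    ∏ j ∈ range n, ((j : ℝ) + 1 / 2) = (2 * n).factorial / (4 ^ n * n.factorial) := by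
  induction n with
  | zero => simp
  | succ n ih =>
    rw [prod_range_succ, ih, factorial_two_mul_add_two, Nat.factorial_succ]
    push_cast
    field_simp
    ring

theorem companion_zero_right (n : ℕ) :
    companion n 0 = 16 ^ (n + 1) /
      (((n : ℝ) + 1) ^ 3 * ((2 * (n + 1)).choose (n + 1) : ℝ) ^ 3) *
      ((6 * ((n : ℝ) + 1) - 2) * ∑ j ∈ range n, invSq j + 1 / ((n : ℝ) + 1)) := by
  have h16 : (16 : ℝ) ^ (n + 1) = (4 ^ (n + 1)) ^ 2 := by
    rw [← pow_mul, mul_comm, pow_mul]; norm_num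
  rw [cast_choose_two_mul, companion, term, harm, add_zero, prod_range_add_half (n + 1),
    factorial_two_mul_add_two, h16]
  simp only [Nat.factorial_succ, Nat.cast_zero, prod_range_zero, sum_range_zero]
  push_cast
  field_simp
  ring

theorem hasSum_companion : HasSum (fun n => companion n 0) (Real.pi ^ 4 / 24) := by
  have hsum : HasSum (fun k => term 0 k * harm 0 k) (Real.pi ^ 4 / 24) := by
    have h := hasSum_mul_sum_range halfInvSq_nonneg hasSum_halfInvSq hasSum_halfInvSq_sq
    convert! h using 1
    · ext k
      simp [term_zero_left, harm]
    · ring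
  refine hasSum_of_wz_pair (F := fun n k => term n k * harm n k) wz_pair
    (hasSum_halfInvSq.summable.mul_right (Real.pi ^ 2)) (fun n k => ?_) (fun n => ?_)
    (fun n => companion_nonneg n 0) hsum
  · rw [abs_of_nonneg (mul_nonneg (term_pos n k).le (harm_nonneg n k)), ← mul_assoc]
    exact mul_le_mul (term_le n k) (harm_le n k) (harm_nonneg n k)
      (mul_nonneg (by positivity) (halfInvSq_nonneg k))
  · exact squeeze_zero (companion_nonneg n) (companion_le n) (tendsto_const_div_add_one _)

end QuarterSeries

theorem theorem1p2 :
    HasSum (fun k : ℕ+ =>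
        ((21 * (k : ℝ) - 8) * (genHarmonic 2 ((k : ℕ) - 1) : ℝ) + 2 / (k : ℝ)) /
          ((k : ℝ) ^ 3 * (Nat.choose (2 * (k : ℕ)) (k : ℕ) : ℝ) ^ 3))
      (Real.pi ^ 4 / 360) ∧
    HasSum (fun k : ℕ+ =>
        (16 : ℝ) ^ (k : ℕ) / ((k : ℝ) ^ 3 * (Nat.choose (2 * (k : ℕ)) (k : ℕ) : ℝ) ^ 3) *
          ((6 * (k : ℝ) - 2) * (genHarmonic 2 ((k : ℕ) - 1) : ℝ) + 1 / (k : ℝ)))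
      (Real.pi ^ 4 / 24) := by
  constructor
  -- Reindexing by `k = n + 1` turns the harmonic number into a sum over `range n`.
  · rw [← Equiv.pnatEquivNat.symm.hasSum_iff]
    convert! CubeSeries.hasSum_companion.mul_left (1 / 3) using 1
    · ext n
      simp [CubeSeries.companion_zero_right, genHarmonic_two_eq]
    · ring
  · rw [← Equiv.pnatEquivNat.symm.hasSum_iff]
    convert! QuarterSeries.hasSum_companion using 1
    ext n
    simp [QuarterSeries.companion_zero_right, genHarmonic_two_eq]
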